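/- An electricity division instance $D$ with $n\ge 1$ households consists of a time interval $[0,T]$ with $T>0$, a supply $S>0$, and real demands $D[1],\dots,D[n]$ with $0<D[i]\le S$. A set $A\subseteq\{1,\dots,n\}$ is admissible if $\sum_{i\in A}D[i]\le S$. A schedule is a partition of $[0,T]$ into finitely many sub-intervals $I_1,\dots,I_p$ together with an admissible set $A_l$ for each $l$; household $i$ is then connected for the time $u_i=\sum_{l:\,i\in A_l}|I_l|$. The egalitarian connection time of $D$ is the maximum of $\min_i u_i$ over all schedules. For an integer $k\ge 1$, a $k$-times bin packing of $D$ is a finite family of admissible sets (bins) such that each $i\in\{1,\dots,n\}$ lies in exactly $k$ of the bins; $OPT(D_k)$ denotes the smallest possible number of bins. Let $K(D)$ be the smallest integer $k\ge 1$ such that the egalitarian connection time of $D$ is the fraction $\frac{k}{OPT(D_k)}$ of the interval, that is, equals $\frac{k}{OPT(D_k)}\,T$, and let $K(n)$ be the maximum of $K(D)$ over all instances $D$ with $n$ households. Proposition. For $n=6$ the numbers $K(D)$ and the maximum $K(6)$ are well defined, and $$K(6)=9.$$ The maximum is attained by the demands $[4,2,5,3,2,1]$ with $S=9$: for this instance $OPT(D_9)=17$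 and $K(D)=9$. -/

import Mathlib

/-- An electricity division instance with `n` households: a time interval `[0, T]`, a supply `S`,
and a list of positive demands, each of which can be served on its own (otherwise no packing of
the households exists). -/
structure ElectricityInstance (n : ℕ) where
  /-- The length `T` of the time interval `[0, T]`. -/
  horizon : ℝ
  /-- The supply `S`, which is also the bin capacity. -/
  supply : ℝ
  /-- The demand `D[i]` of household `i`. -/
  demand : Fin n → ℝ
  horizon_pos : 0 < horizon
  supply_pos : 0 < supply
  demand_pos : ∀ i, 0 < demand i
  demand_le_supply : ∀ i, demand i ≤ supply

namespace ElectricityInstance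

/-- A set of households that can be connected simultaneously
(equivalently, the content of an admissible bin). -/
def Admissible {n : ℕ} (D : ElectricityInstance n) (A : Finset (Fin n)) : Prop :=
  ∑ i ∈ A, D.demand i ≤ D.supply

/-- A schedule: a partition `0 = t₀ ≤ t₁ ≤ ⋯ ≤ t_p = T` of `[0, T]` into consecutive
sub-intervals, and for each of them an admissible set of connected households. -/
structure Schedule {n : ℕ} (D : ElectricityInstance n) where
  /-- The number of sub-intervals. -/
  p : ℕ
  /-- The end points of the sub-intervals. -/
  t : Fin (p + 1) → ℝ
  t_mono : Monotone t
  t_zero : t 0 = 0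
  t_last : t (Fin.last p) = D.horizon
  /-- The set of households connected during the `l`-th sub-interval. -/
  connected : Fin p → Finset (Fin n)
  admissible : ∀ l, D.Admissible (connected l)

/-- The total time during which household `i` is connected. -/
def Schedule.utility {n : ℕ} {D : ElectricityInstance n} (σ : D.Schedule) (i : Fin n) : ℝ :=
  ∑ l : Fin σ.p with i ∈ σ.connected l, (σ.t l.succ - σ.t l.castSucc)

/-- `v` is the egalitarian connection time `max_σ min_i u_i(σ)`; the maximum is attained.
(The infimum over `Fin n` is a minimum as soon as there is a household.) -/
def IsEgalitarianTime {n : ℕ} (D : ElectricityInstance n) (v : ℝ) : Prop :=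
  IsGreatest (Set.range fun σ : D.Schedule => ⨅ i, σ.utility i) v

/-- `B` is a `k`-times bin packing into `q` bins: every bin respects the capacity and every item
lies in exactly `k` of the bins (at most once in each, since bins are sets of items). -/
def IsPacking {n : ℕ} (D : ElectricityInstance n) (k q : ℕ) (B : Fin q → Finset (Fin n)) : Prop :=
  (∀ j, D.Admissible (B j)) ∧ ∀ i, (Finset.univ.filter fun j => i ∈ B j).card = k

/-- `OPT(D_k)`: the least number of bins in a `k`-times bin packing. -/
noncomputable def opt {n : ℕ} (D : ElectricityInstance n) (k : ℕ) : ℕ :=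
  sInf {q | ∃ B : Fin q → Finset (Fin n), D.IsPacking k q B}

/-- The integers `k ≥ 1` for which the fraction `k / OPT(D_k)` of the time interval is the
egalitarian connection time. -/
def optimalMultiplicities {n : ℕ} (D : ElectricityInstance n) : Set ℕ :=
  {k | 1 ≤ k ∧ D.IsEgalitarianTime ((k : ℝ) / (D.opt k : ℝ) * D.horizon)}

/-- `K(D)`: the smallest `k` such that the egalitarian connection time is `k / OPT(D_k)`. -/
noncomputable def minK {n : ℕ} (D : ElectricityInstance n) : ℕ :=
  sInf D.optimalMultiplicities

end ElectricityInstance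

/-- `K(n)`: the maximum of `K(D)` over all instances `D` with `n` households. -/
noncomputable def maxMinK (n : ℕ) : ℕ :=
  sSup (Set.range fun D : ElectricityInstance n => D.minK)

/-!
Let `τ` be the optimum of the linear program of fractional bin covers. Schedules are fractional
covers, so the egalitarian connection time is `T / τ`, and `K(D)` is the least `k` for which
`OPT(D_k) = k τ`. The optimum is attained at a vertex, and by Cramer's rule the coordinates of a
vertex have the common denominator `|det B|` for some `n × n` matrix `B` with entries `0` and `1`;
clearing denominators gives `K(D) ≤ |det B|`.

For `n = 6` such a determinant is at most `9`: bordering `B` yields a `±1` matrix of order `7` whose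
determinant is `64` times larger, and it suffices that the latter is smaller than `640`. Following
Ehlich, negate rows so that all row products are `1`; then the Gram matrix has diagonal `7` and
entries congruent to `3` modulo `4`. If its determinant were at least `640²`, Fischer's inequality
would force it to be a block matrix with entries `3` inside and `-1` outside the blocks, and the
determinants of those are explicit. Conversely, the demands `4, 2, 5, 3, 2, 1` have a `9`-times
packing into `17` completely full bins, and `9` and `17` are coprime.
-/

section Fischer

open Matrix
open scoped ComplexOrder MatrixOrder

variable {𝕜 l m n : Type*} [RCLike 𝕜] [Fintype l] [DecidableEq l] [Fintype m] [DecidableEq m]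
  [Fintype n] [DecidableEq n]

theorem one_le_det_one_add {X : Matrix n n 𝕜} (hX : X.PosSemidef) : 1 ≤ (1 + X).det := by
  have hH : (1 + X).IsHermitian := isHermitian_one.add hX.isHermitian
  have heigenvalue (i : n) : 1 ≤ hH.eigenvalues i := by
    rw [hH.eigenvalues_eq, add_mulVec, one_mulVec, dotProduct_add, map_add, dotProduct_comm,
      ← EuclideanSpace.inner_eq_star_dotProduct, inner_self_eq_norm_sq,
      hH.eigenvectorBasis.norm_eq_one, one_pow]
    exact le_add_of_nonneg_right (hX.re_dotProduct_nonneg _)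
  rw [hH.det_eq_prod_eigenvalues]
  exact_mod_cast Finset.one_le_prod fun i _ => heigenvalue i

theorem det_le_det_add {P X : Matrix n n 𝕜} (hP : P.PosSemidef) (hX : X.PosSemidef) :
    P.det ≤ (P + X).det := by
  by_cases hdet : P.det = 0
  · rw [hdet]
    exact (hP.add hX).det_nonneg
  have hP' : P.PosDef := hP.posDef_iff_det_ne_zero.mpr hdet
  obtain ⟨B, hB⟩ : ∃ B : Matrix n n 𝕜, P⁻¹ = Bᴴ * B :=
    CStarAlgebra.nonneg_iff_eq_star_mul_self.mp hP'.inv.posSemidef.nonneg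
  have hfactor : (P + X).det = (1 + B * X * Bᴴ).det * P.det := by
    rw [Matrix.mul_assoc, det_one_add_mul_comm, Matrix.mul_assoc, ← hB, ← det_mul, add_mul,
      Matrix.one_mul, Matrix.mul_assoc, nonsing_inv_mul _ hP'.det_pos.ne'.isUnit, Matrix.mul_one]
  rw [hfactor]
  exact le_mul_of_one_le_left hP.det_nonneg (one_le_det_one_add (hX.mul_mul_conjTranspose_same B))

theorem det_fromBlocks_le_det_mul_det {A : Matrix m m 𝕜} {B : Matrix m n 𝕜} {C : Matrix n m 𝕜}
    {E : Matrix n n 𝕜} (h : (fromBlocks A B C E).PosDef) :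
    (fromBlocks A B C E).det ≤ A.det * E.det := by
  have hA : A.PosDef := h.submatrix Sum.inl_injective
  obtain rfl : Bᴴ = C := (isHermitian_fromBlocks_iff.mp h.isHermitian).2.1
  let := hA.isUnit.invertible
  have hschur : (E - Bᴴ * A⁻¹ * B).PosSemidef := (hA.fromBlocks₁₁ B E).mp h.posSemidef
  have hle := det_le_det_add hschur (hA.inv.posSemidef.conjTranspose_mul_mul_same B)
  rw [sub_add_cancel] at hle
  rw [det_fromBlocks₁₁, invOf_eq_nonsing_inv]
  exact mul_le_mul_of_nonneg_left hle hA.det_pos.le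

theorem det_le_det_submatrix_inl_mul_det_submatrix_inr {G : Matrix l l 𝕜} (hG : G.PosDef)
    (e : m ⊕ n ≃ l) :
    G.det ≤ (G.submatrix (e ∘ Sum.inl) (e ∘ Sum.inl)).det *
      (G.submatrix (e ∘ Sum.inr) (e ∘ Sum.inr)).det := by
  have hblocks := hG.submatrix e.injective
  rw [← det_submatrix_equiv_self e G]
  rw [← fromBlocks_toBlocks (G.submatrix e e)] at hblocks ⊢
  exact det_fromBlocks_le_det_mul_det hblocks

end Fischer

section Clusters

open Matrix Finset

variable {ι κ K : Type*} [Fintype ι] [DecidableEq ι] [Fintype κ] [DecidableEq κ] [Field K]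

theorem det_diagonal_add_vecMulVec {d : κ → K} (hd : ∀ k, d k ≠ 0) (u v : κ → K) :
    (diagonal d + vecMulVec u v).det = (∏ k, d k) * (1 + ∑ k, v k * u k / d k) := by
  have hfactor : diagonal d + vecMulVec u v = diagonal d * (1 + vecMulVec (u / d) v) := by
    ext i j
    simp [mul_add, vecMulVec_apply, diagonal_apply, one_apply, ← mul_assoc, mul_div_cancel₀, hd]
  rw [hfactor, det_mul, det_diagonal, vecMulVec_eq Unit, det_one_add_replicateCol_mul_replicateRow]
  simp only [dotProduct, Pi.div_apply, mul_div_assoc]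

variable [CharZero K]

theorem det_cluster_sub_const (c : ι → κ) (t : K) :
    (of fun i j => (if i = j then 1 else 0) + (if c i = c j then 1 else 0) - t).det =
      (∏ k, (1 + (#{i | c i = k} : K))) *
        (1 - t * ∑ k, (#{i | c i = k} : K) / (1 + #{i | c i = k})) := by
  let N : κ → K := fun k => #{i | c i = k}
  let C : Matrix ι κ K := of fun i k => if c i = k then 1 else 0
  have hC : Cᵀ * C = diagonal N := by
    ext k l
    simp only [mul_apply, C, N, transpose_apply, of_apply, diagonal_apply]
    split_ifs with h
    · simp [h, ← ite_and, sum_boole]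
    · exact sum_eq_zero fun i _ => by grind
  have hN (k : κ) : 1 + N k ≠ 0 := by
    simpa [N, add_comm] using (Nat.cast_add_one_ne_zero #{i | c i = k} : (_ : K) ≠ 0)
  calc
    _ = (1 + C * ((1 - of fun _ _ => t : Matrix κ κ K) * Cᵀ)).det := by
      congr 1
      ext i j
      simp [C, mul_apply, mul_sub, one_apply, add_sub_assoc, eq_comm]
    _ = (diagonal (fun k => 1 + N k) + vecMulVec (fun _ => -t) N).det := by
      rw [det_one_add_mul_comm, Matrix.mul_assoc, hC]
      congr 1
      ext k l
      simp only [sub_mul, Matrix.one_mul, Matrix.add_apply, Matrix.sub_apply, mul_diagonal,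
        vecMulVec_apply, diagonal_apply, one_apply, of_apply]
      split_ifs <;> ring
    _ = _ := by
      rw [det_diagonal_add_vecMulVec hN]
      simp only [N, mul_neg, neg_div, sum_neg_distrib, ← sub_eq_add_neg, mul_comm _ t,
        mul_div_assoc, mul_sum]

-- `2 / 9` is a rational upper bound for `(log (1 + n) - n / (1 + n)) / n`, whose maximum over the
-- natural numbers is about `0.216`, at `n = 2`.
theorem one_add_natCast_le_exp (n : ℕ) : (1 + n : ℝ) ≤ Real.exp (2 / 9 * n + n / (1 + n)) := by
  have taylor {x y : ℝ} (hx : 0 ≤ x) (h : y ≤ ∑ i ∈ range 6, x ^ i / i.factorial) :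
      y ≤ Real.exp x := h.trans (Real.sum_le_exp_of_nonneg hx 6)
  obtain rfl | rfl | rfl | h : n = 0 ∨ n = 1 ∨ n = 2 ∨ 3 ≤ n := by omega
  · simp
  · exact taylor (by norm_num) (by norm_num [sum_range_succ, Nat.factorial])
  · exact taylor (by norm_num) (by norm_num [sum_range_succ, Nat.factorial])
  induction n, h using Nat.le_induction with
  | base => exact taylor (by norm_num) (by norm_num [sum_range_succ, Nat.factorial])
  | succ n h ih =>
    have h' : (3 : ℝ) ≤ n := mod_cast h
    calc (1 + (n + 1 : ℕ) : ℝ) = (1 + n) * (1 / (1 + n) + 1) := by push_cast; field_simp; ring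
      _ ≤ Real.exp (2 / 9 * n + n / (1 + n)) * Real.exp (1 / (1 + n)) := by
        gcongr
        exact Real.add_one_le_exp _
      _ = Real.exp (2 / 9 * n + 1) := by
        rw [← Real.exp_add]
        congr 1
        field_simp
        ring
      _ ≤ _ := by
        have hle : (2 / 9 : ℝ) ≥ 1 / (1 + (n + 1 : ℕ)) := by
          push_cast
          rw [ge_iff_le, div_le_div_iff₀ (by positivity) (by norm_num)]
          linarith
        have heq : ((n + 1 : ℕ) : ℝ) / (1 + (n + 1 : ℕ)) = 1 - 1 / (1 + (n + 1 : ℕ)) := by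
          field_simp
          ring
        rw [Real.exp_le_exp, heq]
        push_cast at hle ⊢
        linarith

theorem prod_one_add_mul_sub_le_exp {κ : Type*} [Fintype κ] (s : κ → ℕ) :
    (∏ k, (1 + s k : ℝ)) * (4 - ∑ k, (s k / (1 + s k) : ℝ)) ≤
      Real.exp (2 / 9 * ∑ k, (s k : ℝ) + 3) := by
  set x : ℝ := ∑ k, (s k / (1 + s k) : ℝ)
  have hprod : ∏ k, (1 + s k : ℝ) ≤ Real.exp (2 / 9 * ∑ k, (s k : ℝ) + x) := by
    rw [mul_sum, ← sum_add_distrib, Real.exp_sum]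
    exact prod_le_prod (fun k _ => by positivity) fun k _ => one_add_natCast_le_exp (s k)
  calc
    _ ≤ (∏ k, (1 + s k : ℝ)) * Real.exp (3 - x) := by
      gcongr
      linarith [Real.add_one_le_exp (3 - x)]
    _ ≤ Real.exp (2 / 9 * ∑ k, (s k : ℝ) + x) * Real.exp (3 - x) := by gcongr
    _ = _ := by rw [← Real.exp_add]; ring_nf

theorem exp_two_ninths_mul_seven_add_three_lt : Real.exp (2 / 9 * 7 + 3) < 100 := by
  refine lt_of_pow_lt_pow_left₀ 9 (by norm_num) ?_
  calc Real.exp (2 / 9 * 7 + 3) ^ 9 = Real.exp 1 ^ 41 := by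
        rw [← Real.exp_nat_mul, ← Real.exp_nat_mul]
        norm_num
    _ < 2.7182818286 ^ 41 := by gcongr; exact Real.exp_one_lt_d9
    _ < 100 ^ 9 := by norm_num

end Clusters

section Ehlich

open Matrix Finset

/-- The integers congruent to `3` modulo `4` and of absolute value at most `7`. -/
def ehlichEntries : Finset ℤ := {-5, -1, 3, 7}

/-- Ehlich's normal form for the Gram matrix of `±1` vectors of length `7`: once the coordinates of
each vector multiply to `1`, all inner products are congruent to `3` modulo `4`. -/
structure IsEhlichGram {ι : Type*} (G : Matrix ι ι ℤ) : Prop where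
  apply_comm (i j : ι) : G i j = G j i
  apply_self (i : ι) : G i i = 7
  apply_mem (i j : ι) : G i j ∈ ehlichEntries

theorem exists_sum_equiv_apply_inl {l m n : Type*} [Fintype l] [Fintype m] [Fintype n]
    {f : m → l} (hf : f.Injective) (hcard : Fintype.card m + Fintype.card n = Fintype.card l) :
    ∃ e : m ⊕ n ≃ l, e ∘ Sum.inl = f := by
  classical
  have e : n ≃ ↥(Set.range f)ᶜ := Fintype.equivOfCardEq <| by
    rw [Fintype.card_compl_set, Set.card_range_of_injective hf]
    omega
  exact ⟨(Equiv.ofInjective f hf).sumCongr e |>.trans (Equiv.Set.sumCompl _), rfl⟩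

theorem exists_det_le_det_submatrix_mul_det_submatrix {l m n : Type*} [Fintype l] [DecidableEq l]
    [Fintype m] [DecidableEq m] [Fintype n] [DecidableEq n] {G : Matrix l l ℤ}
    (hpos : (G.map (Int.cast : ℤ → ℝ)).PosDef) {f : m → l} (hf : f.Injective)
    (hcard : Fintype.card m + Fintype.card n = Fintype.card l) :
    ∃ g : n → l, g.Injective ∧ G.det ≤ (G.submatrix f f).det * (G.submatrix g g).det := by
  obtain ⟨e, he⟩ := exists_sum_equiv_apply_inl hf hcard
  refine ⟨e ∘ Sum.inr, e.injective.comp Sum.inr_injective, ?_⟩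
  have hreal := det_le_det_submatrix_inl_mul_det_submatrix_inr hpos e
  simp only [he, submatrix_map, ← Int.cast_det] at hreal
  exact_mod_cast hreal

namespace IsEhlichGram

theorem submatrix {ι κ : Type*} {G : Matrix ι ι ℤ} (hG : IsEhlichGram G) (f : κ → ι) :
    IsEhlichGram (G.submatrix f f) :=
  ⟨fun _ _ => hG.apply_comm _ _, fun _ => hG.apply_self _, fun _ _ => hG.apply_mem _ _⟩

theorem det_four_le_of_forall_eq {G : Matrix (Fin 4) (Fin 4) ℤ} (hG : IsEhlichGram G)
    (h : ∀ i j, i ≠ j → G i j = -1 ∨ G i j = 3) : G.det ≤ 2048 := by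
  have hpoly : ∀ a ∈ ({-1, 3} : Finset ℤ), ∀ b ∈ ({-1, 3} : Finset ℤ),
      ∀ c ∈ ({-1, 3} : Finset ℤ), ∀ d ∈ ({-1, 3} : Finset ℤ),
      ∀ e ∈ ({-1, 3} : Finset ℤ), ∀ f ∈ ({-1, 3} : Finset ℤ),
      2401 - 49 * (a ^ 2 + b ^ 2 + c ^ 2 + d ^ 2 + e ^ 2 + f ^ 2) +
        14 * (a * b * d + a * c * e + b * c * f + d * e * f) +
        (a * f - b * e - c * d) ^ 2 - 4 * b * c * d * e ≤ 2048 := by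
    decide +kernel
  have hmem (i j : Fin 4) (hij : i ≠ j) : G i j ∈ ({-1, 3} : Finset ℤ) := by
    simpa using h i j hij
  refine Eq.trans_le ?_ (hpoly _ (hmem 0 1 (by decide)) _ (hmem 0 2 (by decide))
    _ (hmem 0 3 (by decide)) _ (hmem 1 2 (by decide)) _ (hmem 1 3 (by decide))
    _ (hmem 2 3 (by decide)))
  simp [det_succ_row_zero, Fin.sum_univ_succ, Fin.succAbove, hG.apply_self, hG.apply_comm 1 0,
    hG.apply_comm 2 0, hG.apply_comm 3 0, hG.apply_comm 2 1, hG.apply_comm 3 1, hG.apply_comm 3 2]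
  ring

theorem det_two {G : Matrix (Fin 2) (Fin 2) ℤ} (hG : IsEhlichGram G) :
    G.det = 49 - G 0 1 ^ 2 := by
  rw [det_fin_two, hG.apply_self, hG.apply_self, hG.apply_comm 1 0]
  ring

theorem det_four_le {G : Matrix (Fin 4) (Fin 4) ℤ} (hG : IsEhlichGram G)
    (hpos : (G.map (Int.cast : ℤ → ℝ)).PosDef) : G.det ≤ 2048 := by
  by_cases h : ∀ i j, i ≠ j → G i j = -1 ∨ G i j = 3
  · exact hG.det_four_le_of_forall_eq h
  push Not at h
  obtain ⟨i, j, hij, hneg, hthree⟩ := h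
  have hinj : (![i, j] : Fin 2 → Fin 4).Injective := by
    simpa [Function.Injective, Fin.forall_fin_two] using ⟨hij, hij.symm⟩
  obtain ⟨g, -, hle⟩ := exists_det_le_det_submatrix_mul_det_submatrix (n := Fin 2) hpos hinj rfl
  rw [(hG.submatrix _).det_two, (hG.submatrix _).det_two] at hle
  have hlarge : ∀ x ∈ ehlichEntries, ∀ y ∈ ehlichEntries, x ≠ -1 → x ≠ 3 →
      (49 - x ^ 2) * (49 - y ^ 2) ≤ 2048 := by
    decide
  exact hle.trans (hlarge _ (hG.apply_mem i j) _ (hG.apply_mem (g 0) (g 1)) hneg hthree)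

theorem apply_of_le_det {G : Matrix (Fin 3) (Fin 3) ℤ} (hG : IsEhlichGram G) (hdet : 200 ≤ G.det) :
    (G 0 1 = -1 ∨ G 0 1 = 3) ∧ (G 0 1 = 3 → G 1 2 = 3 → G 0 2 = 3) := by
  have hpoly : ∀ a ∈ ehlichEntries, ∀ b ∈ ehlichEntries,
      ∀ c ∈ ehlichEntries, 200 ≤ 343 + 2 * a * b * c - 7 * (a ^ 2 + b ^ 2 + c ^ 2) →
      (a = -1 ∨ a = 3) ∧ (a = 3 → c = 3 → b = 3) := by
    decide
  refine hpoly _ (hG.apply_mem 0 1) _ (hG.apply_mem 0 2) _ (hG.apply_mem 1 2) (hdet.trans_eq ?_)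
  rw [det_fin_three, hG.apply_comm 1 0, hG.apply_comm 2 0, hG.apply_comm 2 1, hG.apply_self,
    hG.apply_self, hG.apply_self]
  ring

variable {ι : Type*} [Fintype ι] [DecidableEq ι] {G : Matrix ι ι ℤ}

theorem le_det_submatrix (hG : IsEhlichGram G)
    (hpos : (G.map (Int.cast : ℤ → ℝ)).PosDef) (hι : Fintype.card ι = 7) (hdet : 640 ^ 2 ≤ G.det)
    {f : Fin 3 → ι} (hf : f.Injective) : 200 ≤ (G.submatrix f f).det := by
  obtain ⟨g, hg, hfischer⟩ :=
    exists_det_le_det_submatrix_mul_det_submatrix (n := Fin 4) hpos hf (by simp [hι])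
  have hminor : 0 < (G.submatrix f f).det := by
    have hreal := (hpos.submatrix hf).det_pos
    rw [submatrix_map, ← Int.cast_det] at hreal
    exact_mod_cast hreal
  -- `200 * 2048 = 640 ^ 2`
  nlinarith [(hG.submatrix g).det_four_le (hpos.submatrix hg)]

theorem exists_setoid_apply_eq (hG : IsEhlichGram G)
    (hpos : (G.map (Int.cast : ℤ → ℝ)).PosDef) (hι : Fintype.card ι = 7) (hdet : 640 ^ 2 ≤ G.det) :
    ∃ s : Setoid ι, ∀ i j, i ≠ j → G i j = 3 ∧ s i j ∨ G i j = -1 ∧ ¬ s i j := by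
  have htriple {i j k : ι} (hij : i ≠ j) (hik : i ≠ k) (hjk : j ≠ k) :
      (G i j = -1 ∨ G i j = 3) ∧ (G i j = 3 → G j k = 3 → G i k = 3) := by
    have hinj : (![i, j, k] : Fin 3 → ι).Injective := by
      intro a b
      fin_cases a <;> fin_cases b <;> simp [hij, hik, hjk, hij.symm, hik.symm, hjk.symm]
    exact (hG.submatrix _).apply_of_le_det (hG.le_det_submatrix hpos hι hdet hinj)
  have hpair {i j : ι} (hij : i ≠ j) : G i j = -1 ∨ G i j = 3 := by
    obtain ⟨k, -, hk⟩ := exists_mem_notMem_of_card_lt_card (s := {i, j}) (t := univ)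
      (card_le_two.trans_lt (by rw [card_univ, hι]; norm_num))
    simp only [mem_insert, mem_singleton, not_or] at hk
    exact (htriple hij (Ne.symm hk.1) (Ne.symm hk.2)).1
  refine ⟨⟨fun i j => i = j ∨ G i j = 3, fun i => Or.inl rfl, ?_, ?_⟩, fun i j hij => ?_⟩
  · rintro i j (rfl | h)
    · exact Or.inl rfl
    · exact Or.inr (hG.apply_comm _ _ ▸ h)
  · rintro i j k (rfl | hij) (rfl | hjk)
    · exact Or.inl rfl
    · exact Or.inr hjk
    · exact Or.inr hij
    · by_contra! hik
      have := hG.apply_self i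
      have := hG.apply_self j
      exact hik.2 ((htriple (by grind) hik.1 (by grind)).2 hij hjk)
  · change G i j = 3 ∧ (i = j ∨ G i j = 3) ∨ G i j = -1 ∧ ¬(i = j ∨ G i j = 3)
    grind

theorem det_lt (hG : IsEhlichGram G)
    (hpos : (G.map (Int.cast : ℤ → ℝ)).PosDef) (hι : Fintype.card ι = 7) : G.det < 640 ^ 2 := by
  classical
  by_contra! hdet
  obtain ⟨s, hs⟩ := hG.exists_setoid_apply_eq hpos hι hdet
  have hentry : (G.map (Int.cast : ℤ → ℝ)) = (4 : ℝ) • of fun i j => (if i = j then 1 else 0) +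
      (if (⟦i⟧ : Quotient s) = ⟦j⟧ then 1 else 0) - (1 / 4 : ℝ) := by
    ext i j
    obtain rfl | hij := eq_or_ne i j
    · norm_num [hG.apply_self]
    · obtain ⟨h, h'⟩ | ⟨h, h'⟩ := hs i j hij <;> norm_num [Quotient.eq, *]
  have hcard : ∑ k, (#{i | (⟦i⟧ : Quotient s) = k} : ℝ) = 7 := by
    exact_mod_cast (card_eq_sum_card_fiberwise fun i _ => mem_univ _).symm.trans hι
  have hbound := prod_one_add_mul_sub_le_exp fun k => #{i | (⟦i⟧ : Quotient s) = k}
  have hdet' := congrArg det hentry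
  rw [det_smul, hι, det_cluster_sub_const] at hdet'
  rw [hcard] at hbound
  have : (G.det : ℝ) < 640 ^ 2 := by
    rw [Int.cast_det]
    linarith [exp_two_ninths_mul_seven_add_three_lt]
  exact this.not_ge (mod_cast hdet)

end IsEhlichGram

theorem sum_units_modEq {ι : Type*} (s : Finset ι) (v : ι → ℤˣ) :
    ∑ i ∈ s, (v i : ℤ) ≡ #s + (∏ i ∈ s, v i : ℤˣ) - 1 [ZMOD 4] := by
  classical
  induction s using Finset.induction_on with
  | empty => rfl
  | insert a s ha ih =>
    rw [sum_insert ha, prod_insert ha, card_insert_of_notMem ha]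
    refine (ih.add_left (v a)).trans ?_
    obtain h | h := Int.units_eq_one_or (v a) <;>
      obtain h' | h' := Int.units_eq_one_or (∏ i ∈ s, v i) <;>
        simp only [h, h', Int.modEq_iff_dvd] <;> push_cast <;> ring_nf <;> norm_num

variable {ι : Type*} [Fintype ι]

theorem isEhlichGram_mul_transpose {M : Matrix ι ι ℤˣ} (hι : Fintype.card ι = 7)
    (hprod : ∀ i, ∏ j, M i j = 1) :
    IsEhlichGram (M.map Units.val * (M.map Units.val)ᵀ) := by
  have hinner (i j : ι) : (M.map Units.val * (M.map Units.val)ᵀ) i j =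
      ∑ l, ((M i l * M j l : ℤˣ) : ℤ) := by simp [mul_apply]
  refine ⟨fun i j => ?_, fun i => ?_, fun i j => ?_⟩
  · simp only [hinner, mul_comm]
  · simp [hinner, hι]
  · have hmod := sum_units_modEq univ fun l => M i l * M j l
    rw [prod_mul_distrib, hprod, hprod, card_univ, hι, ← hinner] at hmod
    have habs : |∑ l, ((M i l * M j l : ℤˣ) : ℤ)| ≤ 7 := by
      refine (abs_sum_le_sum_abs _ _).trans_eq ?_
      simp only [Int.abs_eq_natAbs, Int.units_natAbs, sum_const, card_univ, hι]
      rfl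
    rw [← hinner, abs_le] at habs
    simp only [ehlichEntries, mem_insert, mem_singleton]
    simp only [Int.ModEq, Units.val_one, Nat.cast_ofNat, mul_one] at hmod
    omega

variable [DecidableEq ι]

theorem posDef_map_mul_transpose {B : Matrix ι ι ℤ} (hB : B.det ≠ 0) :
    ((B * Bᵀ).map (Int.cast : ℤ → ℝ)).PosDef := by
  have hunit : IsUnit (B.map (Int.cast : ℤ → ℝ)) := by
    rw [isUnit_iff_isUnit_det, ← Int.cast_det]
    exact (Int.cast_ne_zero.mpr hB).isUnit
  have hmul := Matrix.map_mul (L := B) (M := Bᵀ) (f := Int.castRingHom ℝ)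
  rw [show (B * Bᵀ).map (Int.cast : ℤ → ℝ) = B.map Int.cast * (B.map Int.cast)ᴴ from hmul]
  exact PosDef.mul_conjTranspose_self _ (vecMul_injective_of_isUnit hunit)

theorem sq_det_lt {M : Matrix ι ι ℤˣ} (hι : Fintype.card ι = 7) :
    (M.map Units.val).det ^ 2 < 640 ^ 2 := by
  obtain hdet | hdet := eq_or_ne (M.map Units.val).det 0
  · norm_num [hdet]
  let s : ι → ℤˣ := fun i => ∏ l, M i l
  let N : Matrix ι ι ℤˣ := of fun i j => s i * M i j
  have hprod (i : ι) : ∏ j, N i j = 1 := by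
    simp [N, prod_mul_distrib, s, hι, Int.units_pow_eq_pow_mod_two]
  have hN : N.map Units.val = diagonal (fun i => (s i : ℤ)) * M.map Units.val := by
    ext; simp [N]
  have hdetN : (N.map Units.val).det ^ 2 = (M.map Units.val).det ^ 2 := by
    rw [hN, det_mul, det_diagonal, mul_pow, ← Finset.prod_pow]
    simp [← Units.val_pow_eq_pow_val]
  have hpos : ((N.map Units.val * (N.map Units.val)ᵀ).map (Int.cast : ℤ → ℝ)).PosDef :=
    posDef_map_mul_transpose
      (by rwa [← pow_ne_zero_iff two_ne_zero, hdetN, pow_ne_zero_iff two_ne_zero])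
  calc _ = (N.map Units.val * (N.map Units.val)ᵀ).det := by
        rw [det_mul, det_transpose, ← sq, hdetN]
    _ < _ := (isEhlichGram_mul_transpose hι hprod).det_lt hpos hι

theorem exists_sign_matrix_det_eq {A : Matrix ι ι ℤ} (hA : ∀ i j, A i j = 0 ∨ A i j = 1) :
    ∃ M : Matrix (Unit ⊕ ι) (Unit ⊕ ι) ℤˣ,
      (M.map Units.val).det = (-2) ^ Fintype.card ι * A.det := by
  refine ⟨fromBlocks (of fun _ _ => 1) (of fun _ _ => 1) (of fun _ _ => 1)
    (of fun i j => if A i j = 0 then 1 else -1), ?_⟩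
  have hone : (of fun _ _ => 1 : Matrix Unit Unit ℤˣ).map Units.val = 1 := by
    ext
    simp
  rw [fromBlocks_map, hone, det_fromBlocks_one₁₁, ← det_smul]
  congr 1
  ext i j
  obtain h | h := hA i j <;> simp [h, mul_apply]

theorem abs_det_le_nine {A : Matrix ι ι ℤ} (hι : Fintype.card ι = 6)
    (hA : ∀ i j, A i j = 0 ∨ A i j = 1) : |A.det| ≤ 9 := by
  obtain ⟨M, hM⟩ := exists_sign_matrix_det_eq hA
  have hlt := abs_lt_of_sq_lt_sq (sq_det_lt (M := M) (by simp [hι])) (by norm_num)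
  have hpow : |(-2 : ℤ) ^ 6| = 64 := by norm_num
  rw [hM, hι, abs_mul, hpow] at hlt
  omega

end Ehlich

section LinearProgram

open Matrix Finset Set Filter Topology

theorem exists_mem_extremePoints_isMinOn {E : Type*} [AddCommGroup E] [Module ℝ E]
    [TopologicalSpace E] [T2Space E] [IsTopologicalAddGroup E] [ContinuousSMul ℝ E]
    [LocallyConvexSpace ℝ E] {P : Set E} (f : StrongDual ℝ E) {r : ℝ}
    (hcompact : IsCompact {x ∈ P | f x ≤ r}) (hne : {x ∈ P | f x ≤ r}.Nonempty) :
    ∃ x ∈ P.extremePoints ℝ, IsMinOn f P x := by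
  obtain ⟨x₀, hx₀, hmin⟩ := hcompact.exists_isMinOn hne f.continuous.continuousOn
  have hface : (-f).toExposed P = {x ∈ P | f x ≤ r} ∩ {x | f x ≤ f x₀} := by
    ext x
    simp only [ContinuousLinearMap.toExposed, _root_.neg_apply, neg_le_neg_iff, mem_inter_iff,
      mem_ofPred_eq]
    refine ⟨fun h => ⟨⟨h.1, (h.2 _ hx₀.1).trans hx₀.2⟩, h.2 _ hx₀.1⟩,
      fun h => ⟨h.1.1, fun y hy => ?_⟩⟩
    obtain hyr | hyr := le_total (f y) r
    · exact h.2.trans (hmin ⟨hy, hyr⟩)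
    · exact h.1.2.trans hyr
  have hface_compact : IsCompact ((-f).toExposed P) :=
    hface ▸ hcompact.inter_right (isClosed_le f.continuous continuous_const)
  obtain ⟨x, hx⟩ := hface_compact.extremePoints_nonempty (hface ▸ ⟨x₀, hx₀, le_refl (f x₀)⟩)
  have hextreme : IsExtreme ℝ P ((-f).toExposed P) :=
    ContinuousLinearMap.toExposed.isExposed.isExtreme
  refine ⟨x, hextreme.extremePoints_subset_extremePoints hx, fun y hy => ?_⟩
  simpa using hx.1.2 y hy

variable {m ι : Type*} [Fintype ι]

/-- The feasible set of a linear program in standard form. -/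
def feasibleSet (M : Matrix m ι ℝ) (b : m → ℝ) : Set (ι → ℝ) :=
  {x | 0 ≤ x ∧ M *ᵥ x = b}

theorem isClosed_feasibleSet (M : Matrix m ι ℝ) (b : m → ℝ) : IsClosed (feasibleSet M b) :=
  (isClosed_le continuous_const continuous_id).inter (isClosed_eq (by fun_prop) continuous_const)

-- A dependency among the columns of the support is a direction in which `x` can move both ways.
theorem linearIndepOn_support_of_mem_extremePoints {M : Matrix m ι ℝ} {b : m → ℝ} {x : ι → ℝ}
    (hx : x ∈ (feasibleSet M b).extremePoints ℝ) :
    LinearIndepOn ℝ M.col x.support := by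
  obtain ⟨⟨hx0, hxb⟩, hext⟩ := mem_extremePoints.mp hx
  rw [linearIndepOn_iff]
  intro z hz hcomb
  have hMz : M *ᵥ z = 0 := by
    ext i
    rw [← hcomb, Finsupp.linearCombination_apply, Finsupp.sum_fintype _ _ (by simp)]
    simp [mulVec, dotProduct, mul_comm]
  have hsmall : ∀ᶠ ε : ℝ in 𝓝[>] 0, ∀ i, ε * |z i| ≤ x i := by
    refine eventually_all.mpr fun i => ?_
    obtain hi | hi := (hx0 i).eq_or_lt
    · have : z i = 0 := by_contra fun h => hz (Finsupp.mem_support_iff.mpr h) hi.symm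
      simp [this, ← hi]
    · have hlim : Tendsto (fun ε : ℝ => ε * |z i|) (𝓝[>] 0) (𝓝 0) :=
        tendsto_nhdsWithin_of_tendsto_nhds (Continuous.tendsto' (by fun_prop) _ _ (zero_mul _))
      exact (hlim.eventually_lt_const hi).mono fun _ => le_of_lt
  obtain ⟨ε, hε, hεpos⟩ := (hsmall.and self_mem_nhdsWithin).exists
  have hmem (s : ℝ) (hs : |s| = ε) : x + s • ⇑z ∈ feasibleSet M b := by
    refine ⟨fun i => ?_, by rw [mulVec_add, mulVec_smul, hMz, smul_zero, add_zero, hxb]⟩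
    have := neg_abs_le (s * z i)
    rw [abs_mul, hs] at this
    simp only [Pi.zero_apply, Pi.add_apply, Pi.smul_apply, smul_eq_mul]
    linarith [hε i]
  have heq := (hext _ (hmem ε (abs_of_pos hεpos)) _ (hmem (-ε) (by rw [abs_neg, abs_of_pos hεpos]))
    ⟨1 / 2, 1 / 2, by norm_num, by norm_num, by norm_num, by module⟩).1
  ext i
  simpa [hεpos.ne'] using congrFun heq i

theorem map_det_mul_eq_map_cramer {R S : Type*} [CommRing R] [CommRing S] (φ : R →+* S)
    [Fintype m] [DecidableEq m] {A : Matrix m m R} {b : m → R} {x : m → S}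
    (h : A.map φ *ᵥ x = φ ∘ b) (j : m) : φ A.det * x j = φ (A.cramer b j) := by
  have hadj : A.adjugate.map φ * A.map φ = φ A.det • 1 := by
    rw [← Matrix.map_mul, adjugate_mul, Matrix.map_smul' _ _ _ (map_mul φ),
      Matrix.map_one _ (map_zero φ) (map_one φ)]
  calc φ A.det * x j = (A.adjugate.map φ *ᵥ (A.map φ *ᵥ x)) j := by
        rw [mulVec_mulVec, hadj, smul_mulVec, one_mulVec, Pi.smul_apply, smul_eq_mul]
    _ = φ (A.cramer b j) := by
        rw [h, cramer_eq_adjugate_mulVec, φ.map_mulVec]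

theorem exists_det_mul_eq_intCast_of_mem_extremePoints [Fintype m] [DecidableEq m]
    {N : Matrix m ι ℤ} {b : m → ℤ} {x : ι → ℝ}
    (hspan : Submodule.span ℝ (range (N.map (Int.cast : ℤ → ℝ)).col) = ⊤)
    (hx : x ∈ (feasibleSet (N.map (Int.cast : ℤ → ℝ)) fun i => (b i : ℝ)).extremePoints ℝ) :
    ∃ f : m → ι, (N.submatrix id f).det ≠ 0 ∧
      ∀ i, ∃ a : ℤ, (N.submatrix id f).det * x i = a := by
  set M := N.map (Int.cast : ℤ → ℝ)
  obtain ⟨s, -, hsupp, hs, hli⟩ := exists_linearIndepOn_extension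
    (linearIndepOn_support_of_mem_extremePoints hx) (subset_univ _)
  have hspan' : ⊤ ≤ Submodule.span ℝ (range fun i : s => M.col i) := by
    rw [← hspan, Submodule.span_le, ← image_univ]
    rwa [image_eq_range M.col s] at hs
  let B := Module.Basis.mk hli hspan'
  let e : m ≃ s := (Pi.basisFun ℝ m).indexEquiv B
  have hdet : (N.submatrix id fun i => (e i : ι)).det ≠ 0 := by
    have hcols : LinearIndependent ℝ (M.submatrix id fun i => (e i : ι)).col :=
      hli.comp e e.injective
    rw [linearIndependent_cols_iff_isUnit, isUnit_iff_isUnit_det, isUnit_iff_ne_zero] at hcols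
    rwa [← Int.cast_ne_zero (α := ℝ), Int.cast_det]
  refine ⟨fun i => e i, hdet, fun i => ?_⟩
  by_cases hi : i ∈ s
  · set A := N.submatrix id fun i => (e i : ι)
    have hAx : A.map (Int.cast : ℤ → ℝ) *ᵥ (fun j => x (e j)) = fun i => (b i : ℝ) := by
      rw [← hx.1.2]
      ext l
      refine Fintype.sum_of_injective (fun j => (e j : ι))
        (Subtype.val_injective.comp e.injective) _ _ (fun i' hi' => ?_) fun _ => rfl
      have his : i' ∉ s := fun h => hi' ⟨e.symm ⟨i', h⟩, by simp⟩
      rw [Function.notMem_support.mp fun h => his (hsupp h), mul_zero]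
    exact ⟨A.cramer b (e.symm ⟨i, hi⟩), by
      simpa using map_det_mul_eq_map_cramer (Int.castRingHom ℝ) hAx (e.symm ⟨i, hi⟩)⟩
  · refine ⟨0, ?_⟩
    rw [Function.notMem_support.mp fun h => hi (hsupp h), mul_zero, Int.cast_zero]

end LinearProgram

section FractionalCovers

open Matrix Finset Set

variable {m ι : Type*} [DecidableEq m]

/-- The coefficient matrix of `N x - s`: turns the inequalities `b ≤ N x` into equations by means
of slack variables `s`. -/
def withSlack {R : Type*} [Ring R] (N : Matrix m ι R) : Matrix m (ι ⊕ m) R :=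
  fromCols N (-1)

theorem span_range_col_withSlack [Finite m] (N : Matrix m ι ℝ) :
    Submodule.span ℝ (range (withSlack N).col) = ⊤ := by
  rw [eq_top_iff, ← (Pi.basisFun ℝ m).span_eq, Submodule.span_le]
  rintro _ ⟨i, rfl⟩
  rw [SetLike.mem_coe, ← neg_mem_iff]
  refine Submodule.subset_span ⟨.inr i, ?_⟩
  ext k
  simp [withSlack, one_apply, Pi.single_apply]

variable [Fintype m]

theorem abs_det_submatrix_withSlack (N : Matrix m ι ℤ) (f : m → ι ⊕ m) :
    |((withSlack N).submatrix id f).det| = |((fromCols N 1).submatrix id f).det| := by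
  have hscale : (withSlack N).submatrix id f =
      of fun i j =>
        Sum.elim (1 : ι → ℤ) (-1 : m → ℤ) (f j) * (fromCols N 1).submatrix id f i j := by
    ext i j
    rcases hk : f j with k | k <;> simp [withSlack, hk]
  rw [hscale, det_mul_row, abs_mul, abs_prod, prod_eq_one, one_mul]
  intro j _
  rcases f j with _ | _ <;> simp

variable [Fintype ι]

theorem withSlack_mulVec {R : Type*} [Ring R] (N : Matrix m ι R) (z : ι ⊕ m → R) :
    withSlack N *ᵥ z = N *ᵥ (z ∘ .inl) - z ∘ .inr := by
  rw [withSlack, fromCols_mulVec, neg_mulVec, one_mulVec, sub_eq_add_neg]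

/-- The fractional covers of the rows of a matrix by its columns. -/
def fractionalCovers (N : Matrix m ι ℝ) : Set (ι → ℝ) :=
  {x | 0 ≤ x ∧ 1 ≤ N *ᵥ x}

theorem comp_inl_mem_fractionalCovers {N : Matrix m ι ℝ} {z : ι ⊕ m → ℝ}
    (hz : z ∈ feasibleSet (withSlack N) 1) : z ∘ Sum.inl ∈ fractionalCovers N := by
  refine ⟨fun j => hz.1 (.inl j), fun i => ?_⟩
  have hi : 0 ≤ z (.inr i) := hz.1 _
  have heq := congrFun hz.2 i
  simp only [withSlack_mulVec, Pi.sub_apply, Function.comp_apply, Pi.one_apply] at heq ⊢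
  linarith

theorem sumElim_mem_feasibleSet {N : Matrix m ι ℝ} {x : ι → ℝ}
    (hx : x ∈ fractionalCovers N) :
    Sum.elim x (N *ᵥ x - 1) ∈ feasibleSet (withSlack N) 1 := by
  refine ⟨?_, ?_⟩
  · rintro (j | i)
    · exact hx.1 j
    · exact sub_nonneg.mpr (hx.2 i)
  · rw [withSlack_mulVec, Sum.elim_comp_inl, Sum.elim_comp_inr, sub_sub_cancel]

theorem isCompact_sep_sum_le {N : Matrix m ι ℝ} (hN : ∀ i j, N i j ≤ 1) (r : ℝ) :
    IsCompact {z ∈ feasibleSet (withSlack N) 1 | ∑ j, z (.inl j) ≤ r} := by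
  refine (isCompact_Icc (a := (0 : ι ⊕ m → ℝ)) (b := fun _ => r)).of_isClosed_subset ?_ ?_
  · exact (isClosed_feasibleSet _ _).inter
      (isClosed_le (f := fun z : ι ⊕ m → ℝ => ∑ j, z (.inl j)) (by fun_prop) continuous_const)
  · rintro z ⟨hz, hr⟩
    refine ⟨hz.1, ?_⟩
    rintro (j | i)
    · exact (single_le_sum (fun j _ => hz.1 (.inl j)) (mem_univ j)).trans hr
    · have hle : (N *ᵥ (z ∘ Sum.inl)) i ≤ ∑ j, z (.inl j) :=
        sum_le_sum fun j _ => mul_le_of_le_one_left (hz.1 _) (hN i j)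
      have heq := congrFun hz.2 i
      simp only [withSlack_mulVec, Pi.sub_apply, Function.comp_apply, Pi.one_apply] at heq
      linarith

theorem exists_mem_extremePoints_isMinOn_sum {N : Matrix m ι ℝ} (hN : ∀ i j, N i j ≤ 1)
    (hne : (fractionalCovers N).Nonempty) :
    ∃ z ∈ (feasibleSet (withSlack N) 1).extremePoints ℝ,
      IsMinOn (fun x => ∑ j, x j) (fractionalCovers N) (z ∘ Sum.inl) := by
  obtain ⟨x₀, hx₀⟩ := hne
  let total : StrongDual ℝ (ι ⊕ m → ℝ) := ∑ j, .proj (.inl j)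
  have htotal (z : ι ⊕ m → ℝ) : total z = ∑ j, z (.inl j) := by simp [total]
  have hcompact := isCompact_sep_sum_le hN (∑ j, x₀ j)
  simp only [← htotal] at hcompact
  obtain ⟨z, hz, hmin⟩ := exists_mem_extremePoints_isMinOn total hcompact
    ⟨_, sumElim_mem_feasibleSet hx₀, by simp [htotal]⟩
  refine ⟨z, hz, fun y hy => ?_⟩
  simpa [htotal] using hmin (sumElim_mem_feasibleSet hy)

theorem exists_isMinOn_sum_fractionalCovers {N : Matrix m ι ℤ}
    (hN : ∀ i j, N i j = 0 ∨ N i j = 1)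
    (hne : (fractionalCovers (N.map (Int.cast : ℤ → ℝ))).Nonempty) :
    ∃ x ∈ fractionalCovers (N.map (Int.cast : ℤ → ℝ)),
      IsMinOn (fun x => ∑ j, x j) (fractionalCovers (N.map (Int.cast : ℤ → ℝ))) x ∧
      ∃ B : Matrix m m ℤ, (∀ i j, B i j = 0 ∨ B i j = 1) ∧ B.det ≠ 0 ∧
        ∀ j, ∃ a : ℕ, B.det.natAbs * x j = a := by
  obtain ⟨z, hz, hmin⟩ := exists_mem_extremePoints_isMinOn_sum
    (fun i j => by obtain h | h := hN i j <;> simp [h]) hne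
  refine ⟨z ∘ Sum.inl, comp_inl_mem_fractionalCovers hz.1, hmin, ?_⟩
  have hmap : withSlack (N.map (Int.cast : ℤ → ℝ)) = (withSlack N).map Int.cast := by
    ext i (j | j)
    · rfl
    · simp [withSlack, one_apply, apply_ite]
  have hone : (1 : m → ℝ) = fun i => ((1 : m → ℤ) i : ℝ) := by ext; simp
  have hspan := span_range_col_withSlack (N.map (Int.cast : ℤ → ℝ))
  have hnonneg := hz.1.1
  rw [hmap] at hspan
  rw [hmap, hone] at hz
  obtain ⟨f, hf, hfz⟩ := exists_det_mul_eq_intCast_of_mem_extremePoints hspan hz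
  rw [← abs_ne_zero, abs_det_submatrix_withSlack, abs_ne_zero] at hf
  refine ⟨(fromCols N 1).submatrix id f, fun i j => ?_, hf, fun j => ?_⟩
  · rcases hk : f j with k | k
    · simpa [hk] using hN i k
    · simpa [hk, one_apply] using (ne_or_eq i k).imp_right id
  · obtain ⟨a, ha⟩ := hfz (.inl j)
    refine ⟨a.natAbs, ?_⟩
    rw [Nat.cast_natAbs, Nat.cast_natAbs, ← abs_det_submatrix_withSlack, Int.cast_abs,
      Int.cast_abs, ← ha, abs_mul, Function.comp_apply, abs_of_nonneg (hnonneg (Sum.inl j))]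

end FractionalCovers

namespace ElectricityInstance

open Matrix Finset

variable {n k q : ℕ} {D : ElectricityInstance n}

theorem Admissible.mono {A B : Finset (Fin n)} (hA : D.Admissible A) (hBA : B ⊆ A) :
    D.Admissible B :=
  (sum_le_sum_of_subset_of_nonneg hBA fun i _ _ => (D.demand_pos i).le).trans hA

theorem admissible_singleton (i : Fin n) : D.Admissible {i} := by
  simpa [Admissible] using D.demand_le_supply i

/-- The columns of the linear program whose fractional covers relax the bin packings of `D`. -/
abbrev Bin (D : ElectricityInstance n) : Type := {A : Finset (Fin n) // D.Admissible A}

noncomputable instance : Fintype D.Bin := Fintype.ofFinite _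

/-- The household-bin incidence matrix. -/
def incidence (D : ElectricityInstance n) : Matrix (Fin n) D.Bin ℤ :=
  of fun i A => if i ∈ A.1 then 1 else 0

theorem incidence_eq_zero_or_one (i : Fin n) (A : D.Bin) :
    D.incidence i A = 0 ∨ D.incidence i A = 1 :=
  (ite_eq_or_eq _ _ _).symm

/-- The fractional bin covers of `D`: bins get nonnegative weights such that every household is
covered with weight at least `1`. -/
def binCovers (D : ElectricityInstance n) : Set (D.Bin → ℝ) :=
  fractionalCovers (D.incidence.map (Int.cast : ℤ → ℝ))

/-- The least total weight `τ` of a fractional bin cover. -/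
noncomputable def fractionalOpt (D : ElectricityInstance n) : ℝ :=
  sInf ((fun x => ∑ A, x A) '' D.binCovers)

theorem mem_binCovers {x : D.Bin → ℝ} :
    x ∈ D.binCovers ↔ 0 ≤ x ∧ ∀ i, 1 ≤ ∑ A with i ∈ A.1, x A := by
  simp [binCovers, fractionalCovers, Pi.le_def, mulVec, dotProduct, incidence, sum_filter]

theorem one_mem_binCovers : 1 ∈ D.binCovers :=
  mem_binCovers.mpr ⟨zero_le_one, fun i => single_le_sum
    (f := (1 : D.Bin → ℝ)) (a := ⟨{i}, admissible_singleton i⟩) (fun _ _ => zero_le_one)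
    (by simp)⟩

theorem fractionalOpt_le_sum {x : D.Bin → ℝ} (hx : x ∈ D.binCovers) :
    D.fractionalOpt ≤ ∑ A, x A :=
  csInf_le ⟨0, Set.forall_mem_image.mpr fun _ hy => sum_nonneg fun A _ => (mem_binCovers.mp hy).1 A⟩
    (Set.mem_image_of_mem _ hx)

theorem exists_binCover_sum_eq_fractionalOpt (D : ElectricityInstance n) :
    ∃ x ∈ D.binCovers, ∑ A, x A = D.fractionalOpt ∧
      ∃ B : Matrix (Fin n) (Fin n) ℤ, (∀ i j, B i j = 0 ∨ B i j = 1) ∧ B.det ≠ 0 ∧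
        ∀ A, ∃ a : ℕ, B.det.natAbs * x A = a := by
  obtain ⟨x, hx, hmin, hB⟩ :=
    exists_isMinOn_sum_fractionalCovers D.incidence_eq_zero_or_one ⟨1, one_mem_binCovers⟩
  have hle : ∑ A, x A ≤ D.fractionalOpt :=
    le_csInf ⟨_, Set.mem_image_of_mem _ hx⟩ (Set.forall_mem_image.mpr hmin)
  exact ⟨x, hx, hle.antisymm (fractionalOpt_le_sum hx), hB⟩

theorem one_le_fractionalOpt [NeZero n] : 1 ≤ D.fractionalOpt := by
  obtain ⟨x, hx, hsum, -⟩ := D.exists_binCover_sum_eq_fractionalOpt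
  rw [mem_binCovers] at hx
  rw [← hsum]
  exact (hx.2 0).trans (sum_le_univ_sum_of_nonneg hx.1)

theorem fractionalOpt_nonneg : 0 ≤ D.fractionalOpt := by
  obtain ⟨x, hx, hsum, -⟩ := D.exists_binCover_sum_eq_fractionalOpt
  exact hsum ▸ sum_nonneg fun A _ => (mem_binCovers.mp hx).1 A

theorem sum_demand_le_supply_mul_fractionalOpt :
    ∑ i, D.demand i ≤ D.supply * D.fractionalOpt := by
  obtain ⟨x, hx, hsum, -⟩ := D.exists_binCover_sum_eq_fractionalOpt
  rw [mem_binCovers] at hx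
  calc ∑ i, D.demand i ≤ ∑ i, D.demand i * ∑ A with i ∈ A.1, x A :=
        sum_le_sum fun i _ => le_mul_of_one_le_right (D.demand_pos i).le (hx.2 i)
    _ = ∑ A, (∑ i ∈ A.1, D.demand i) * x A := by
        simp only [mul_sum, sum_mul]
        exact sum_comm' (by simp)
    _ ≤ ∑ A, D.supply * x A :=
        sum_le_sum fun A _ => mul_le_mul_of_nonneg_right A.2 (hx.1 A)
    _ = D.supply * D.fractionalOpt := by rw [← mul_sum, hsum]

theorem mul_fractionalOpt_le_sum {J : Type*} [Fintype J] {C : J → D.Bin} {w : J → ℝ} {c : ℝ}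
    (hw : ∀ j, 0 ≤ w j) (hc : ∀ i, c ≤ ∑ j with i ∈ (C j).1, w j) :
    c * D.fractionalOpt ≤ ∑ j, w j := by
  obtain hc0 | hc0 := le_or_gt c 0
  · exact (mul_nonpos_of_nonpos_of_nonneg hc0 fractionalOpt_nonneg).trans
      (sum_nonneg fun j _ => hw j)
  have hcover : (fun A => (∑ j with C j = A, w j) / c) ∈ D.binCovers := by
    refine mem_binCovers.mpr ⟨fun A => div_nonneg (sum_nonneg fun j _ => hw j) hc0.le, fun i => ?_⟩
    rw [← sum_div, one_le_div₀ hc0, sum_fiberwise_eq_sum_filter]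
    simpa using hc i
  have hle := fractionalOpt_le_sum hcover
  rwa [← sum_div, sum_fiberwise, le_div_iff₀' hc0] at hle

theorem IsPacking.mul_fractionalOpt_le {B : Fin q → Finset (Fin n)} (hB : D.IsPacking k q B) :
    k * D.fractionalOpt ≤ q := by
  simpa using mul_fractionalOpt_le_sum (C := fun j => ⟨B j, hB.1 j⟩) (w := 1)
    (fun _ => zero_le_one) fun i => by simp [hB.2 i]

theorem IsPacking.mul_fractionalOpt_eq_of_forall_sum_eq {B : Fin q → Finset (Fin n)}
    (hB : D.IsPacking k q B) (hfull : ∀ j, ∑ i ∈ B j, D.demand i = D.supply) :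
    k * D.fractionalOpt = q := by
  have hvolume : k * ∑ i, D.demand i = q * D.supply := by
    calc k * ∑ i, D.demand i = ∑ i, ∑ j with i ∈ B j, D.demand i := by
          simp [hB.2, mul_sum]
      _ = ∑ j, ∑ i ∈ B j, D.demand i := sum_comm' (by simp)
      _ = q * D.supply := by simp [hfull]
  refine hB.mul_fractionalOpt_le.antisymm (le_of_mul_le_mul_right ?_ D.supply_pos)
  calc q * D.supply = k * ∑ i, D.demand i := hvolume.symm
    _ ≤ k * (D.supply * D.fractionalOpt) :=
        mul_le_mul_of_nonneg_left sum_demand_le_supply_mul_fractionalOpt k.cast_nonneg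
    _ = k * D.fractionalOpt * D.supply := by ring

theorem IsPacking.opt_eq {B : Fin q → Finset (Fin n)} (hB : D.IsPacking k q B)
    (hq : k * D.fractionalOpt = q) : D.opt k = q := by
  refine le_antisymm (Nat.sInf_le ⟨B, hB⟩) (le_csInf ⟨q, B, hB⟩ ?_)
  rintro r ⟨C, hC⟩
  exact_mod_cast hq ▸ hC.mul_fractionalOpt_le

theorem exists_isPacking_of_le_card {J : Type*} [Fintype J] {C : J → D.Bin}
    (hk : ∀ i, k ≤ #{j | i ∈ (C j).1}) :
    ∃ B, D.IsPacking k (Fintype.card J) B := by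
  classical
  choose s hs hscard using fun i => exists_subset_card_eq (hk i)
  let e := Fintype.equivFin J
  refine ⟨fun j => {i | e.symm j ∈ s i}, fun j => (C (e.symm j)).2.mono fun i hi => ?_, fun i => ?_⟩
  · simpa using hs i (mem_filter.mp hi).2
  · rw [← hscard i, ← card_map e.toEmbedding]
    congr 1
    ext j
    simp [mem_map_equiv]

theorem exists_isPacking_natAbs_det (D : ElectricityInstance n) :
    ∃ B : Matrix (Fin n) (Fin n) ℤ, (∀ i j, B i j = 0 ∨ B i j = 1) ∧ B.det ≠ 0 ∧
      ∃ q C, D.IsPacking B.det.natAbs q C ∧ B.det.natAbs * D.fractionalOpt = q := by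
  obtain ⟨x, hx, hsum, B, h01, hdet, hint⟩ := D.exists_binCover_sum_eq_fractionalOpt
  choose y hy using hint
  have hcover (i : Fin n) : B.det.natAbs ≤ #{j : Σ A, Fin (y A) | i ∈ j.1.1} := by
    have hcard : #{j : Σ A, Fin (y A) | i ∈ j.1.1} = ∑ A with i ∈ A.1, y A := by
      rw [sum_filter, card_filter, Fintype.sum_sigma]
      exact sum_congr rfl fun A _ => by split_ifs <;> simp [*]
    rw [hcard, ← Nat.cast_le (α := ℝ), Nat.cast_sum]
    simp only [← hy, ← mul_sum]
    exact le_mul_of_one_le_right (Nat.cast_nonneg _) ((mem_binCovers.mp hx).2 i)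
  obtain ⟨C, hC⟩ := exists_isPacking_of_le_card hcover
  refine ⟨B, h01, hdet, _, C, hC, ?_⟩
  simp only [← hsum, mul_sum, hy, Fintype.card_sigma, Fintype.card_fin, Nat.cast_sum]

/-- The schedule that gives every bin of a packing the same amount of time. -/
noncomputable def IsPacking.schedule {B : Fin q → Finset (Fin n)} (hB : D.IsPacking k q B)
    (hq : 0 < q) : D.Schedule where
  p := q
  t l := l * (D.horizon / q)
  t_mono a b hab := mul_le_mul_of_nonneg_right (Nat.cast_le.mpr hab)
    (div_nonneg D.horizon_pos.le q.cast_nonneg)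
  t_zero := by simp
  t_last := mul_div_cancel₀ _ (by positivity)
  connected := B
  admissible := hB.1

theorem IsPacking.utility_schedule {B : Fin q → Finset (Fin n)} (hB : D.IsPacking k q B)
    (hq : 0 < q) (i : Fin n) :
    (hB.schedule hq).utility i = k / q * D.horizon := by
  have hlength (l : Fin q) :
      (hB.schedule hq).t l.succ - (hB.schedule hq).t l.castSucc = D.horizon / q := by
    simp [schedule, add_mul]
  calc (hB.schedule hq).utility i = ∑ l with i ∈ B l, D.horizon / q :=
        sum_congr rfl fun l _ => hlength l
    _ = k / q * D.horizon := by
        rw [sum_const, hB.2 i, nsmul_eq_mul, mul_div_assoc', div_mul_eq_mul_div]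

theorem Schedule.sum_length (σ : D.Schedule) :
    ∑ l : Fin σ.p, (σ.t l.succ - σ.t l.castSucc) = D.horizon := by
  rw [sum_sub_distrib]
  linarith [Fin.sum_univ_succ σ.t, Fin.sum_univ_castSucc σ.t, σ.t_zero, σ.t_last]

theorem Schedule.iInf_utility_le [NeZero n] (σ : D.Schedule) :
    ⨅ i, σ.utility i ≤ D.horizon / D.fractionalOpt := by
  rw [le_div_iff₀ (one_pos.trans_le one_le_fractionalOpt), ← σ.sum_length]
  exact mul_fractionalOpt_le_sum (C := fun l => ⟨σ.connected l, σ.admissible l⟩)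
    (fun l => sub_nonneg.mpr (σ.t_mono l.castSucc_le_succ)) (ciInf_le (Set.finite_range _).bddBelow)

theorem isEgalitarianTime_div_fractionalOpt [NeZero n] (D : ElectricityInstance n) :
    D.IsEgalitarianTime (D.horizon / D.fractionalOpt) := by
  refine ⟨?_, Set.forall_mem_range.mpr Schedule.iInf_utility_le⟩
  obtain ⟨B, -, hdet, q, C, hC, hq⟩ := D.exists_isPacking_natAbs_det
  have hτ := one_pos.trans_le D.one_le_fractionalOpt
  have hk : (0 : ℝ) < B.det.natAbs := by exact_mod_cast Int.natAbs_pos.mpr hdet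
  have hq0 : 0 < q := by exact_mod_cast hq ▸ mul_pos hk hτ
  refine ⟨hC.schedule hq0, ?_⟩
  simp only [hC.utility_schedule, ciInf_const, ← hq]
  field_simp

theorem mem_optimalMultiplicities_iff [NeZero n] :
    k ∈ D.optimalMultiplicities ↔ 1 ≤ k ∧ k * D.fractionalOpt = D.opt k := by
  have hτ := one_pos.trans_le D.one_le_fractionalOpt
  refine and_congr_right fun hk => ⟨fun h => ?_, fun h => ?_⟩
  · have heq := h.unique D.isEgalitarianTime_div_fractionalOpt
    have hopt : (D.opt k : ℝ) ≠ 0 := by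
      intro h0
      rw [h0, div_zero, zero_mul] at heq
      exact (div_pos D.horizon_pos hτ).ne heq
    have := D.horizon_pos
    field_simp at heq
    linarith
  · convert D.isEgalitarianTime_div_fractionalOpt using 1
    rw [← h]
    field_simp

theorem IsPacking.mem_optimalMultiplicities [NeZero n] {B : Fin q → Finset (Fin n)}
    (hB : D.IsPacking k q B) (hk : 1 ≤ k) (hq : k * D.fractionalOpt = q) :
    k ∈ D.optimalMultiplicities :=
  mem_optimalMultiplicities_iff.mpr ⟨hk, by rw [hB.opt_eq hq, hq]⟩

theorem exists_natAbs_det_mem_optimalMultiplicities [NeZero n] (D : ElectricityInstance n) :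
    ∃ B : Matrix (Fin n) (Fin n) ℤ, (∀ i j, B i j = 0 ∨ B i j = 1) ∧
      B.det.natAbs ∈ D.optimalMultiplicities := by
  obtain ⟨B, h01, hdet, q, C, hC, hq⟩ := D.exists_isPacking_natAbs_det
  exact ⟨B, h01, hC.mem_optimalMultiplicities (Int.natAbs_pos.mpr hdet) hq⟩

theorem isLeast_minK [NeZero n] (D : ElectricityInstance n) :
    IsLeast D.optimalMultiplicities D.minK := by
  obtain ⟨B, -, hB⟩ := D.exists_natAbs_det_mem_optimalMultiplicities
  exact ⟨Nat.sInf_mem ⟨_, hB⟩, fun _ => Nat.sInf_le⟩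

theorem minK_le_nine (D : ElectricityInstance 6) : D.minK ≤ 9 := by
  obtain ⟨B, h01, hB⟩ := D.exists_natAbs_det_mem_optimalMultiplicities
  refine (D.isLeast_minK.2 hB).trans ?_
  zify
  exact abs_det_le_nine (Fintype.card_fin 6) h01

theorem IsPacking.minK_eq_of_coprime [NeZero n] {B : Fin q → Finset (Fin n)}
    (hB : D.IsPacking k q B) (hk : 1 ≤ k) (hq : k * D.fractionalOpt = q) (hkq : k.Coprime q) :
    D.minK = k := by
  refine D.isLeast_minK.unique ⟨hB.mem_optimalMultiplicities hk hq, fun j hj => ?_⟩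
  obtain ⟨hj1, hj⟩ := mem_optimalMultiplicities_iff.mp hj
  have hcross : j * q = k * D.opt j := by
    rify
    rw [← hq, ← hj]
    ring
  exact Nat.le_of_dvd hj1 (hkq.dvd_of_dvd_mul_right ⟨_, hcross⟩)

/-- A `9`-times packing of the demands `4, 2, 5, 3, 2, 1` into `17` bins of size `9`, all of them
full. -/
def perfectBins : Fin 17 → Finset (Fin 6) :=
  ![{0, 2}, {0, 1, 3}, {0, 1, 3}, {0, 3, 4}, {0, 3, 4}, {1, 2, 4}, {1, 2, 4}, {1, 2, 4},
    {2, 3, 5}, {2, 3, 5}, {2, 3, 5}, {2, 3, 5}, {2, 3, 5},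
    {0, 1, 4, 5}, {0, 1, 4, 5}, {0, 1, 4, 5}, {0, 1, 4, 5}]

theorem card_filter_mem_perfectBins (i : Fin 6) : #{j | i ∈ perfectBins j} = 9 := by
  revert i
  decide

theorem sum_perfectBins (j : Fin 17) :
    ∑ i ∈ perfectBins j, (![4, 2, 5, 3, 2, 1] : Fin 6 → ℝ) i = 9 := by
  have hcast : (![4, 2, 5, 3, 2, 1] : Fin 6 → ℝ) = Nat.cast ∘ ![4, 2, 5, 3, 2, 1] := by
    ext i
    fin_cases i <;> simp
  have hnat : ∀ j, ∑ i ∈ perfectBins j, (![4, 2, 5, 3, 2, 1] : Fin 6 → ℕ) i = 9 := by decide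
  simp only [hcast, Function.comp_apply]
  exact_mod_cast hnat j

variable {D : ElectricityInstance 6}

theorem isPacking_perfectBins (hd : D.demand = ![4, 2, 5, 3, 2, 1]) (hS : D.supply = 9) :
    D.IsPacking 9 17 perfectBins :=
  ⟨fun j => by rw [Admissible, hd, hS, sum_perfectBins], card_filter_mem_perfectBins⟩

theorem nine_mul_fractionalOpt_eq (hd : D.demand = ![4, 2, 5, 3, 2, 1]) (hS : D.supply = 9) :
    (9 : ℕ) * D.fractionalOpt = (17 : ℕ) :=
  (isPacking_perfectBins hd hS).mul_fractionalOpt_eq_of_forall_sum_eq fun j => by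
    rw [hd, hS, sum_perfectBins]

theorem opt_nine_eq (hd : D.demand = ![4, 2, 5, 3, 2, 1]) (hS : D.supply = 9) : D.opt 9 = 17 :=
  (isPacking_perfectBins hd hS).opt_eq (nine_mul_fractionalOpt_eq hd hS)

theorem minK_eq_nine (hd : D.demand = ![4, 2, 5, 3, 2, 1]) (hS : D.supply = 9) : D.minK = 9 :=
  (isPacking_perfectBins hd hS).minK_eq_of_coprime (by norm_num)
    (nine_mul_fractionalOpt_eq hd hS) (by norm_num)

/-- The extremal demands on a time interval of length `1`. -/
def extremalInstance : ElectricityInstance 6 where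
  horizon := 1
  supply := 9
  demand := ![4, 2, 5, 3, 2, 1]
  horizon_pos := one_pos
  supply_pos := by norm_num
  demand_pos i := by fin_cases i <;> simp
  demand_le_supply i := by fin_cases i <;> norm_num [Matrix.cons_val]

theorem isGreatest_nine : IsGreatest (Set.range fun D : ElectricityInstance 6 => D.minK) 9 :=
  ⟨⟨extremalInstance, minK_eq_nine rfl rfl⟩, Set.forall_mem_range.mpr minK_le_nine⟩

end ElectricityInstance

theorem maxMinK_six : maxMinK 6 = 9 :=
  ElectricityInstance.isGreatest_nine.csSup_eq

/-- `K(6) = 9`. The first two conjuncts say that `K(D)` and `K(6)` are a genuine minimum and a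
genuine maximum; the last one says that the maximum is attained by the demands
`4, 2, 5, 3, 2, 1` with supply `9`, for which `OPT(D_9) = 17`. -/
theorem mainTheorem8 :
    (∀ D : ElectricityInstance 6, IsLeast D.optimalMultiplicities D.minK) ∧
    IsGreatest (Set.range fun D : ElectricityInstance 6 => D.minK) (maxMinK 6) ∧
    maxMinK 6 = 9 ∧
    ∀ D : ElectricityInstance 6, D.demand = ![4, 2, 5, 3, 2, 1] → D.supply = 9 →
      D.opt 9 = 17 ∧ D.minK = 9 := by
  refine ⟨fun D => D.isLeast_minK, ?_, maxMinK_six, fun D hd hS => ⟨?_, ?_⟩⟩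
  · exact maxMinK_six ▸ ElectricityInstance.isGreatest_nine
  · exact ElectricityInstance.opt_nine_eq hd hS
  · exact ElectricityInstance.minK_eq_nine hd hS
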